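/- Let $G=(V,w,m)$ be a measured and weighted graph: $V$ is countable, $w:V\times V\to[0,\infty)$ is symmetric and vanishes on the diagonal, $m:V\to(0,\infty)$, every $x\in V$ has only finitely many $y$ with $w(x,y)>0$, and $G$ is connected. Put $q(x,y)=w(x,y)/m(x)$ and assume $\sup_{x}\sum_{y}q(x,y)<\infty$. Let $$\Delta f(x)=\sum_{y}q(x,y)(f(y)-f(x)),\qquad \Gamma(f,g)=\tfrac12\big(\Delta(fg)-f\Delta g-g\Delta f\big),$$ $$\Gamma_2(f,g)=\tfrac12\big(\Delta\Gamma(f,g)-\Gamma(f,\Delta g)-\Gamma(g,\Delta f)\big),\qquad \Gamma f=\Gamma(f,f),\quad \Gamma_2 f=\Gamma_2(f,f),$$ and let $P_t=e^{t\Delta}$, $t\ge 0$, be the heat semigroup on $\ell_\infty(V)$ (the operator exponential; $\Delta$ is a bounded operator on $\ell_\infty(V)$ because the degrees are bounded). Let $K,T>0$, $n\in(0,\infty]$ (with $1/\infty=0$) and $\rho:V\to\mathbb{R}$. Assume that $G$ satisfies $CD(\rho,n)$, i.e. for all bounded $f:V\to\mathbb{R}$ and all $x\in V$, $$\Gamma_2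 f(x)\ \ge\ \rho(x)\,\Gamma f(x)+\tfrac1n(\Delta f(x))^2 ,$$ and that $$k_T\big((\rho-K)_-\big)\le \tfrac14\left(1-e^{-KT/2}\right),$$ where $a_-=-\min\{0,a\}$ and, for $W:V\to[0,\infty)$, $k_T(W)=\sup_{k\in\mathbb{N}}\int_0^T\|P_t(k\wedge W)\|_\infty\,dt\in[0,\infty]$. Then for all $f\in\ell_\infty(V)$ and all $t>0$, pointwise on $V$, $$\Gamma P_t f\ \le\ K e^{KT}\,\frac{1}{\sinh(Kt)}\,\|f\|_\infty^2\ \le\ \frac{e^{KT}}{t}\,\|f\|_\infty^2 .$$ -/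

import Mathlib

open scoped NNReal ENNReal

noncomputable section

/-- `ℓ_∞(V)`, the Banach space of bounded real functions on `V` with the supremum norm. It is
Mathlib's space `lp`, of which only the normed space structure is kept. -/
def Linf (V : Type*) : Type _ := lp (fun _ : V => ℝ) ∞

namespace Linf

variable {V : Type*}

instance : NormedAddCommGroup (Linf V) := inferInstanceAs (NormedAddCommGroup (lp (fun _ : V => ℝ) ∞))

instance : NormedSpace ℝ (Linf V) := inferInstanceAs (NormedSpace ℝ (lp (fun _ : V => ℝ) ∞))

instance : CompleteSpace (Linf V) := inferInstanceAs (CompleteSpace (lp (fun _ : V => ℝ) ∞))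

instance : CoeFun (Linf V) (fun _ => V → ℝ) := ⟨fun f => f.1⟩

@[ext] theorem ext {f g : Linf V} (h : ∀ x, f x = g x) : f = g := Subtype.ext (funext h)

@[simp] theorem add_apply (f g : Linf V) (x : V) : (f + g) x = f x + g x := rfl

@[simp] theorem smul_apply (c : ℝ) (f : Linf V) (x : V) : (c • f) x = c * f x := rfl

theorem norm_def (f : Linf V) : ‖f‖ = ⨆ x, |f x| := lp.norm_eq_ciSup (E := fun _ : V => ℝ) f

theorem abs_apply_le (f : Linf V) (x : V) : |f x| ≤ ‖f‖ :=
  lp.norm_apply_le_norm (E := fun _ : V => ℝ) ENNReal.top_ne_zero f x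

theorem norm_le {f : Linf V} {C : ℝ} (hC : 0 ≤ C) (h : ∀ x, |f x| ≤ C) : ‖f‖ ≤ C :=
  lp.norm_le_of_forall_le (E := fun _ : V => ℝ) hC h

/-- A bounded function as an element of `ℓ_∞(V)`. -/
def mk (f : V → ℝ) (C : ℝ) (h : ∀ x, |f x| ≤ C) : Linf V :=
  ⟨f, memℓp_infty ⟨C, by rintro _ ⟨x, rfl⟩; exact h x⟩⟩

@[simp] theorem mk_apply (f : V → ℝ) (C : ℝ) (h : ∀ x, |f x| ≤ C) (x : V) : mk f C h x = f x := rfl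

end Linf

/-- A measured and weighted graph `(V, w, m)`: countable, locally finite and connected. -/
structure MeasuredWeightedGraph (V : Type*) where
  countable : Countable V
  /-- the symmetric edge weight -/
  w : V → V → ℝ
  /-- the vertex measure -/
  m : V → ℝ
  w_nonneg : ∀ x y, 0 ≤ w x y
  w_symm : ∀ x y, w x y = w y x
  w_self : ∀ x, w x x = 0
  m_pos : ∀ x, 0 < m x
  locallyFinite : ∀ x, {y | 0 < w x y}.Finite
  connected : ∀ x y, Relation.ReflTransGen (fun a b => 0 < w a b) x y

namespace MeasuredWeightedGraph

variable {V : Type*} (G : MeasuredWeightedGraph V)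

/-- The finite set of neighbours of `x`. -/
def nbrs (x : V) : Finset V := (G.locallyFinite x).toFinset

/-- `q(x,y) = w(x,y) / m(x)`. -/
def q (x y : V) : ℝ := G.w x y / G.m x

/-- `Deg(x) = ∑_y q(x,y)`; only neighbours `y` of `x` contribute. -/
def deg (x : V) : ℝ := ∑ y ∈ G.nbrs x, G.q x y

/-- `Deg_max = sup_x Deg(x) < ∞`. -/
def BoundedDegree : Prop := BddAbove (Set.range G.deg)

/-- `Δ f(x) = ∑_y q(x,y) (f(y) - f(x))`; only neighbours `y` of `x` contribute. -/
def lap (f : V → ℝ) (x : V) : ℝ := ∑ y ∈ G.nbrs x, G.q x y * (f y - f x)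

/-- The carré du champ operator `Γ(f,g) = (Δ(fg) - f Δg - g Δf) / 2`. -/
def gam (f g : V → ℝ) (x : V) : ℝ :=
  1 / 2 * (G.lap (f * g) x - f x * G.lap g x - g x * G.lap f x)

/-- The iterated operator `Γ₂(f,g) = (Δ Γ(f,g) - Γ(f,Δg) - Γ(g,Δf)) / 2`. -/
def gam2 (f g : V → ℝ) (x : V) : ℝ :=
  1 / 2 * (G.lap (G.gam f g) x - G.gam f (G.lap g) x - G.gam g (G.lap f) x)

/-- The variable curvature dimension condition `CD(ρ,n)`, for `n ∈ (0,∞]` (with `1/∞ = 0`):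
`Γ₂ f ≥ ρ Γ f + (1/n) (Δ f)²` for all bounded `f`. -/
def CD (ρ : V → ℝ) (n : ℝ≥0∞) : Prop :=
  ∀ f : V → ℝ, (∃ C, ∀ x, |f x| ≤ C) → ∀ x,
    ρ x * G.gam f f x + (n⁻¹).toReal * (G.lap f x) ^ 2 ≤ G.gam2 f f x

theorem q_nonneg (x y : V) : 0 ≤ G.q x y := div_nonneg (G.w_nonneg x y) (G.m_pos x).le

theorem abs_lap_le (f : Linf V) (x : V) :
    |G.lap f x| ≤ 2 * G.deg x * ‖f‖ := by
  have hf := f.abs_apply_le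
  have e : 2 * G.deg x * ‖f‖ = ∑ y ∈ G.nbrs x, G.q x y * (2 * ‖f‖) := by
    rw [← Finset.sum_mul, deg]; ring
  rw [e]
  refine (Finset.abs_sum_le_sum_abs _ _).trans (Finset.sum_le_sum fun y _ => ?_)
  rw [abs_mul, abs_of_nonneg (G.q_nonneg x y)]
  refine mul_le_mul_of_nonneg_left ?_ (G.q_nonneg x y)
  have h1 := abs_sub (f y) (f x)
  have h2 := hf x
  have h3 := hf y
  linarith

variable {G}

theorem BoundedDegree.abs_lap_le (h : G.BoundedDegree) (f : Linf V) (x : V) :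
    |G.lap f x| ≤ 2 * h.some * ‖f‖ := by
  refine (G.abs_lap_le f x).trans (mul_le_mul_of_nonneg_right ?_ (norm_nonneg f))
  have := h.some_mem (Set.mem_range_self x)
  linarith

/-- On a graph of bounded degree, `Δ` as a bounded operator on `ℓ_∞(V)`. -/
def BoundedDegree.lapL (h : G.BoundedDegree) : Linf V →L[ℝ] Linf V :=
  LinearMap.mkContinuousOfExistsBound
    { toFun := fun f => Linf.mk (G.lap f) (2 * h.some * ‖f‖) (h.abs_lap_le f)
      map_add' := fun f g => by
        ext x
        simp only [Linf.mk_apply, Linf.add_apply, lap, ← Finset.sum_add_distrib]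
        exact Finset.sum_congr rfl fun y _ => by ring
      map_smul' := fun c f => by
        ext x
        simp only [Linf.mk_apply, Linf.smul_apply, lap, RingHom.id_apply, Finset.mul_sum]
        exact Finset.sum_congr rfl fun y _ => by ring }
    ⟨2 * |h.some|, fun f => Linf.norm_le (by positivity) fun x =>
      (h.abs_lap_le f x).trans (by have := le_abs_self h.some; gcongr)⟩

theorem BoundedDegree.lapL_apply (h : G.BoundedDegree) (f : Linf V) (x : V) :
    h.lapL f x = G.lap f x := rfl

/-- The heat semigroup `P_t = e^{-tL}`, `L = -Δ`, acting on `ℓ_∞(V)`. On a graph of bounded degree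
the generator is a bounded operator, so this is the operator exponential. -/
def BoundedDegree.heat (h : G.BoundedDegree) (t : ℝ) : Linf V →L[ℝ] Linf V :=
  NormedSpace.exp (t • h.lapL)

/-- The truncation `k ∧ W` of a nonnegative function, an element of `ℓ_∞(V)`. -/
def trunc (k : ℕ) (W : V → ℝ≥0) : Linf V :=
  Linf.mk (fun x => min (k : ℝ) (W x)) k fun x => by
    rw [abs_of_nonneg (le_min k.cast_nonneg (W x).coe_nonneg)]
    exact min_le_left _ _

/-- The Kato constant `k_T(W) = sup_k ∫_0^T ‖P_t (k ∧ W)‖_∞ dt ∈ [0,∞]` of `W : V → [0,∞)`. -/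
def BoundedDegree.kato (h : G.BoundedDegree) (T : ℝ) (W : V → ℝ≥0) : ℝ≥0∞ :=
  ⨆ k : ℕ, ∫⁻ t in Set.Ioc 0 T, ‖h.heat t (trunc k W)‖ₑ

/-- The negative part `f_-(x) = -min{0, f(x)}` of a function. -/
def negPartFun (f : V → ℝ) : V → ℝ≥0 :=
  fun x => ⟨-min 0 (f x), neg_nonneg.mpr (min_le_left _ _)⟩

end MeasuredWeightedGraph

end

/-! Let `W = (ρ - K)_-`. Dropping the dimension term, `CD(ρ,n)` gives `Γ₂ ≥ (K - W) Γ`. The finite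
Kato constant forces `W` to be bounded, since `P_t ≥ e^{-tD}` on nonnegative functions. Hence `Δ +
2W` is a bounded operator generating a positive semigroup, and everything reduces to the comparison
principle `le_exp_smul_apply`, used twice.

Reverse Poincaré (`gam_heat_le`): with `u = P_{t-s} f` and `b' = -2 - 2Kb`, `b(t) = 0`, the function
`u² + b Γu` is a subsolution for `Δ + 2W`. Comparing `s = 0` with `s = t` bounds `b(0) Γ P_t f` by
`e^{t(Δ+2W)} f²`.

Khas'minskii (`exp_schr_one_le_of_le`): a multiple of the potential of `W`, plus `1`, is a
supersolution, so `e^{t(Δ+2W)} 1 ≤ (1 - 2κ)⁻¹ ≤ e^{KT/2}` for `t ≤ T`. The semigroup property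
extends this to `e^{K(T+t)/2}` for all `t`. Since `f² ≤ ‖f‖²`, the theorem follows from `e^{2Kt} - 1
= 2 e^{Kt} sinh(Kt)`. -/

open NormedSpace

noncomputable section

/-! ### Positive operators on bounded functions and their exponentials. -/

namespace Linf

variable {V : Type*}

@[simp] theorem sub_apply (f g : Linf V) (x : V) : (f - g) x = f x - g x := rfl

@[simp] theorem neg_apply (f : Linf V) (x : V) : (-f) x = -f x := rfl

/-- Evaluation at a point. -/
def evalL (x : V) : Linf V →L[ℝ] ℝ :=
  LinearMap.mkContinuous
    { toFun := fun f => f x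
      map_add' := fun _ _ => rfl
      map_smul' := fun _ _ => rfl } 1 fun f => by
    rw [one_mul]; exact f.abs_apply_le x

@[simp] theorem evalL_apply (x : V) (f : Linf V) : evalL x f = f x := rfl

/-- The constant function `1`. -/
def one : Linf V := mk (fun _ => 1) 1 fun _ => by simp

@[simp] theorem one_apply (x : V) : (one : Linf V) x = 1 := rfl

/-- Pointwise multiplication. -/
def mulL : Linf V →L[ℝ] Linf V →L[ℝ] Linf V :=
  LinearMap.mkContinuous₂
    (LinearMap.mk₂ ℝ (fun f g => mk (fun x => f x * g x) (‖f‖ * ‖g‖) fun x => by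
        rw [abs_mul]
        exact mul_le_mul (f.abs_apply_le x) (g.abs_apply_le x) (abs_nonneg _) (norm_nonneg _))
      (fun f g h => by ext x; simp [add_mul])
      (fun c f g => by ext x; simp [mul_assoc])
      (fun f g h => by ext x; simp [mul_add])
      (fun c f g => by ext x; simp [mul_left_comm]))
    1 fun f g => by
      rw [one_mul]
      refine norm_le (by positivity) fun x => ?_
      change |f x * g x| ≤ _
      rw [abs_mul]
      exact mul_le_mul (f.abs_apply_le x) (g.abs_apply_le x) (abs_nonneg _) (norm_nonneg _)

@[simp] theorem mulL_apply (f g : Linf V) (x : V) : mulL f g x = f x * g x := rfl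

/-- An operator on `ℓ_∞(V)` that preserves nonnegative functions. -/
def PosOp (A : Linf V →L[ℝ] Linf V) : Prop :=
  ∀ g : Linf V, (∀ x, 0 ≤ g x) → ∀ x, 0 ≤ A g x

theorem PosOp.mono {A : Linf V →L[ℝ] Linf V} (hA : PosOp A) {f g : Linf V}
    (h : ∀ x, f x ≤ g x) (x : V) : A f x ≤ A g x := by
  have := hA (g - f) (fun y => sub_nonneg.2 (h y)) x
  rw [map_sub, sub_apply] at this
  linarith

theorem PosOp.le_exp {A : Linf V →L[ℝ] Linf V} (hA : PosOp A) {g : Linf V}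
    (hg : ∀ x, 0 ≤ g x) (x : V) : g x ≤ exp A g x := by
  have hpow : ∀ n : ℕ, ∀ y, 0 ≤ (A ^ n) g y := by
    intro n
    induction n with
    | zero => exact hg
    | succ n ih =>
      intro y
      rw [pow_succ']
      exact hA _ ih y
  have hs := (exp_series_hasSum_exp' (𝕂 := ℝ) A).mapL
    ((evalL x).comp (ContinuousLinearMap.apply ℝ (Linf V) g))
  have := le_hasSum hs 0 fun n _ => by
    change 0 ≤ (n.factorial : ℝ)⁻¹ * (A ^ n) g x
    have := hpow n x
    positivity
  simpa using this

theorem exp_eq_smul_exp_add (B : Linf V →L[ℝ] Linf V) (d : ℝ) :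
    exp B = Real.exp (-d) • exp (B + d • (1 : Linf V →L[ℝ] Linf V)) := by
  have hball : ∀ C : Linf V →L[ℝ] Linf V,
      C ∈ Metric.eball 0 (expSeries ℝ (Linf V →L[ℝ] Linf V)).radius := fun C =>
    (expSeries_radius_eq_top ℝ (Linf V →L[ℝ] Linf V)).symm ▸ edist_lt_top _ _
  have h1 : exp ((-d) • (1 : Linf V →L[ℝ] Linf V)) = Real.exp (-d) • 1 := by
    have := algebraMap_exp_comm (𝕂 := ℝ) (𝔸 := Linf V →L[ℝ] Linf V) (-d)
    rw [Algebra.algebraMap_eq_smul_one, Algebra.algebraMap_eq_smul_one] at this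
    rw [← this, Real.exp_eq_exp_ℝ]
  have h2 := exp_add_of_commute_of_mem_ball (𝕂 := ℝ)
    (x := (-d) • (1 : Linf V →L[ℝ] Linf V)) (y := B + d • (1 : Linf V →L[ℝ] Linf V))
    ((Commute.one_left _).smul_left _) (hball _) (hball _)
  rw [h1, smul_mul_assoc, one_mul] at h2
  rw [← h2]
  congr 1
  module

theorem exp_add_smul (B : Linf V →L[ℝ] Linf V) (s t : ℝ) :
    exp ((s + t) • B) = exp (s • B) * exp (t • B) := by
  have hball : ∀ C : Linf V →L[ℝ] Linf V,
      C ∈ Metric.eball 0 (expSeries ℝ (Linf V →L[ℝ] Linf V)).radius := fun C =>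
    (expSeries_radius_eq_top ℝ (Linf V →L[ℝ] Linf V)).symm ▸ edist_lt_top _ _
  rw [add_smul]
  exact exp_add_of_commute_of_mem_ball (𝕂 := ℝ)
    (((Commute.refl B).smul_left _).smul_right _) (hball _) (hball _)

/-- Shifting by `D` costs the scalar `e^{-tD}` and makes every term of the exponential series
positive; the zeroth term alone gives the bound. -/
theorem smul_le_exp_smul {B : Linf V →L[ℝ] Linf V} {D : ℝ} (hB : PosOp (B + D • 1)) {t : ℝ}
    (ht : 0 ≤ t) {g : Linf V} (hg : ∀ x, 0 ≤ g x) (x : V) :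
    Real.exp (-(t * D)) * g x ≤ exp (t • B) g x := by
  have hA : PosOp (t • B + (t * D) • (1 : Linf V →L[ℝ] Linf V)) := fun g hg y => by
    have e : t • B + (t * D) • (1 : Linf V →L[ℝ] Linf V) = t • (B + D • 1) := by module
    rw [e]
    exact mul_nonneg ht (hB g hg y)
  rw [exp_eq_smul_exp_add (t • B) (t * D)]
  exact mul_le_mul_of_nonneg_left (hA.le_exp hg x) (Real.exp_pos _).le

theorem posOp_exp_smul {B : Linf V →L[ℝ] Linf V} {D : ℝ} (hB : PosOp (B + D • 1)) {t : ℝ}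
    (ht : 0 ≤ t) : PosOp (exp (t • B)) := fun _ hg x =>
  (mul_nonneg (Real.exp_pos _).le (hg x)).trans (smul_le_exp_smul hB ht hg x)

theorem hasDerivAt_exp_smul_apply (B : Linf V →L[ℝ] Linf V) (f : Linf V) (s : ℝ) :
    HasDerivAt (fun s : ℝ => exp (s • B) f) (B (exp (s • B) f)) s := by
  simpa using (hasDerivAt_exp_smul_const' B s).clm_apply (hasDerivAt_const s f)

/-- The comparison principle: a subsolution of the backward equation `g' + B g = 0` lies below the
solution with the same terminal value. -/
theorem le_exp_smul_apply {B : Linf V →L[ℝ] Linf V} {D : ℝ} (hB : PosOp (B + D • 1)) {t : ℝ}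
    (ht : 0 ≤ t) {g g' : ℝ → Linf V} (hg : ∀ s, HasDerivAt g (g' s) s)
    (h : ∀ s, 0 ≤ s → s ≤ t → ∀ x, 0 ≤ (B (g s) + g' s) x) (x : V) :
    g 0 x ≤ exp (t • B) (g t) x := by
  have hd : ∀ s : ℝ, HasDerivAt (fun s : ℝ => exp (s • B) (g s) x)
      (exp (s • B) (B (g s) + g' s) x) s := fun s => by
    have := (evalL x).hasFDerivAt.comp_hasDerivAt s
      ((hasDerivAt_exp_smul_const B s).clm_apply (hg s))
    rw [map_add]
    exact this
  have hmono : MonotoneOn (fun s : ℝ => exp (s • B) (g s) x) (Set.Icc 0 t) :=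
    monotoneOn_of_hasDerivWithinAt_nonneg (convex_Icc 0 t)
      (fun s _ => (hd s).continuousAt.continuousWithinAt)
      (fun s _ => (hd s).hasDerivWithinAt) fun s hs => by
        have hs' := interior_subset hs
        exact posOp_exp_smul hB hs'.1 _ (h s hs'.1 hs'.2) x
  have := hmono (Set.left_mem_Icc.2 ht) (Set.right_mem_Icc.2 ht) ht
  simpa [exp_zero] using this

end Linf

/-! ### The generators `Δ` and `Δ + 2W`. -/

namespace MeasuredWeightedGraph

open Linf

variable {V : Type*} {G : MeasuredWeightedGraph V}

theorem gam_self_eq (f : V → ℝ) (x : V) :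
    G.gam f f x = 1 / 2 * ∑ y ∈ G.nbrs x, G.q x y * (f y - f x) ^ 2 := by
  simp only [gam, lap, Finset.mul_sum, ← Finset.sum_sub_distrib, Pi.mul_apply]
  exact Finset.sum_congr rfl fun y _ => by ring

theorem gam_self_nonneg (f : V → ℝ) (x : V) : 0 ≤ G.gam f f x := by
  rw [gam_self_eq]
  have := Finset.sum_nonneg fun y (_ : y ∈ G.nbrs x) =>
    mul_nonneg (G.q_nonneg x y) (sq_nonneg (f y - f x))
  positivity

namespace BoundedDegree

variable (hG : G.BoundedDegree)

/-- The generator `Δ + 2W` of a Schrödinger semigroup. -/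
def schr (W : Linf V) : Linf V →L[ℝ] Linf V := hG.lapL + (2 : ℝ) • mulL W

theorem schr_apply (W f : Linf V) (x : V) :
    hG.schr W f x = G.lap f x + 2 * (W x * f x) := rfl

theorem lap_add_nonneg {g : Linf V} (hg : ∀ x, 0 ≤ g x) (x : V) :
    0 ≤ G.lap g x + hG.some * g x := by
  have h1 : G.lap g x = ∑ y ∈ G.nbrs x, G.q x y * g y - G.deg x * g x := by
    simp only [lap, deg, Finset.sum_mul, ← Finset.sum_sub_distrib]
    exact Finset.sum_congr rfl fun y _ => by ring
  have h2 := Finset.sum_nonneg fun y (_ : y ∈ G.nbrs x) => mul_nonneg (G.q_nonneg x y) (hg y)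
  have h3 := mul_le_mul_of_nonneg_right (hG.some_mem (Set.mem_range_self x)) (hg x)
  linarith

theorem posOp_lapL_add : PosOp (hG.lapL + hG.some • 1) := fun _ hg x =>
  hG.lap_add_nonneg hg x

theorem posOp_schr_add {W : Linf V} (hW : ∀ x, 0 ≤ W x) :
    PosOp (hG.schr W + hG.some • 1) := fun g hg x => by
  change 0 ≤ G.lap g x + 2 * (W x * g x) + hG.some * g x
  have h1 := hG.lap_add_nonneg hg x
  have h2 := mul_nonneg (hW x) (hg x)
  linarith

theorem lapL_one : hG.lapL one = 0 := by
  ext x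
  change G.lap _ x = 0
  simp [lap]

/-- A nonnegative function with finite Kato constant on a graph of bounded degree is bounded. -/
theorem bddAbove_of_kato {T : ℝ} (hT : 0 < T) {W : V → ℝ≥0} {C : ℝ} (hC : 0 ≤ C)
    (hW : hG.kato T W ≤ ENNReal.ofReal C) :
    ∃ k : ℕ, ∀ x, (W x : ℝ) ≤ k := by
  set D := |hG.some|
  have hpos : 0 < T * Real.exp (-(T * D)) := by positivity
  -- If `W x > k`, the integrand is at least `e^{-TD} k` on `(0,T]`, so the integral is at least `T
  -- e^{-TD} k > C`.
  obtain ⟨k, hk⟩ := exists_nat_gt (C / (T * Real.exp (-(T * D))))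
  refine ⟨k, fun x => ?_⟩
  by_contra! hlt
  have h0 : ∀ t ∈ Set.Ioc 0 T,
      ENNReal.ofReal (Real.exp (-(T * D)) * k) ≤ ‖hG.heat t (trunc k W)‖ₑ := fun t ht => by
    have h1 := smul_le_exp_smul hG.posOp_lapL_add ht.1.le (g := trunc k W)
      (fun y => le_min k.cast_nonneg (W y).coe_nonneg) x
    have h2 : (trunc k W) x = k := min_eq_left hlt.le
    rw [h2] at h1
    have h3 : t * hG.some ≤ T * D :=
      (mul_le_mul_of_nonneg_left (le_abs_self _) ht.1.le).trans
        (mul_le_mul_of_nonneg_right ht.2 (abs_nonneg _))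
    rw [← ofReal_norm]
    refine ENNReal.ofReal_le_ofReal ?_
    refine le_trans ?_ ((le_abs_self _).trans ((hG.heat t (trunc k W)).abs_apply_le x))
    refine le_trans ?_ h1
    gcongr
  have h1 : ENNReal.ofReal (Real.exp (-(T * D)) * k) * ENNReal.ofReal T ≤ ENNReal.ofReal C := by
    refine le_trans ?_ ((le_iSup (fun k : ℕ =>
      ∫⁻ t in Set.Ioc 0 T, ‖hG.heat t (trunc k W)‖ₑ) k).trans hW)
    calc _ = ∫⁻ _ in Set.Ioc 0 T, ENNReal.ofReal (Real.exp (-(T * D)) * k) := by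
          simp
      _ ≤ _ := MeasureTheory.setLIntegral_mono' measurableSet_Ioc h0
  rw [← ENNReal.ofReal_mul (by positivity), ENNReal.ofReal_le_ofReal_iff hC] at h1
  rw [div_lt_iff₀ hpos] at hk
  linarith

/-! ### Potentials and Khas'minskii's bound. -/

theorem continuous_heat_apply (f : Linf V) : Continuous fun t => hG.heat t f :=
  continuous_iff_continuousAt.2 fun t => (hasDerivAt_exp_smul_apply hG.lapL f t).continuousAt

/-- The potential `∫_0^s P_r W dr`. -/
def potential (W : Linf V) (s : ℝ) : Linf V := ∫ r in (0 : ℝ)..s, hG.heat r W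

theorem hasDerivAt_potential (W : Linf V) (s : ℝ) :
    HasDerivAt (hG.potential W) (hG.heat s W) s :=
  (hG.continuous_heat_apply W).integral_hasStrictDerivAt 0 s |>.hasDerivAt

theorem lapL_potential (W : Linf V) (s : ℝ) :
    hG.lapL (hG.potential W s) = hG.heat s W - W := by
  have hc := hG.continuous_heat_apply W
  have h := intervalIntegral.integral_eq_sub_of_hasDerivAt (a := 0) (b := s)
    (fun r _ => hasDerivAt_exp_smul_apply hG.lapL W r)
    ((hG.lapL.continuous.comp hc).intervalIntegrable 0 s)
  rw [potential, ← hG.lapL.intervalIntegral_comp_comm (hc.intervalIntegrable 0 s)]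
  refine h.trans ?_
  simp [heat, exp_zero]

theorem potential_apply_le {T κ : ℝ} (hκ : 0 ≤ κ) {W : Linf V}
    (hW : ∫⁻ t in Set.Ioc 0 T, ‖hG.heat t W‖ₑ ≤ ENNReal.ofReal κ) {s : ℝ} (hs : 0 ≤ s)
    (hsT : s ≤ T) (x : V) : hG.potential W s x ≤ κ := by
  refine ((le_abs_self _).trans ((hG.potential W s).abs_apply_le x)).trans ?_
  rw [← ENNReal.ofReal_le_ofReal_iff hκ, ofReal_norm, potential,
    intervalIntegral.integral_of_le hs]
  refine (MeasureTheory.enorm_integral_le_lintegral_enorm _).trans (le_trans ?_ hW)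
  exact MeasureTheory.lintegral_mono_set (Set.Ioc_subset_Ioc_right hsT)

/-- Khas'minskii's lemma. -/
theorem exp_schr_one_le_of_le {T κ : ℝ} (hκ : 0 ≤ κ) (hκ' : 2 * κ < 1) {W : Linf V}
    (hW0 : ∀ x, 0 ≤ W x)
    (hW : ∫⁻ t in Set.Ioc 0 T, ‖hG.heat t W‖ₑ ≤ ENNReal.ofReal κ) {t : ℝ} (ht : 0 ≤ t)
    (htT : t ≤ T) (x : V) : exp (t • hG.schr W) one x ≤ (1 - 2 * κ)⁻¹ := by
  have hpos : 0 < 1 - 2 * κ := by linarith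
  -- For `v(s) = 1 + c ∫_0^{t-s} P_r W dr`, one has `v' + (Δ + 2W) v = W (2v - c)`. This is
  -- nonpositive once `v ≤ c/2`. As `v ≤ 1 + cκ`, the choice of `c` is the solution of `1 + cκ =
  -- c/2`. Comparison is applied to `-v`.
  set c : ℝ := 2 * (1 - 2 * κ)⁻¹ with hc
  have hc0 : 0 ≤ c := by positivity
  have hcκ : 1 + c * κ = (1 - 2 * κ)⁻¹ := by rw [hc]; field_simp; ring
  have hpot : ∀ s, 0 ≤ s → s ≤ T → ∀ y, 1 + c * hG.potential W s y ≤ (1 - 2 * κ)⁻¹ :=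
    fun s hs hsT y => by
      rw [← hcκ]
      gcongr
      exact hG.potential_apply_le hκ hW hs hsT y
  have hd : ∀ s : ℝ, HasDerivAt (fun s => -(one + c • hG.potential W (t - s)))
      (c • hG.heat (t - s) W) s := fun s => by
    have h1 : HasDerivAt (fun s : ℝ => t - s) (-1) s := by
      simpa using (hasDerivAt_id s).const_sub t
    have h2 := ((hG.hasDerivAt_potential W (t - s)).scomp s h1).const_smul c
    have h3 := (h2.const_add one).neg
    exact h3.congr_deriv (by module)
  have := le_exp_smul_apply (hG.posOp_schr_add hW0) ht hd (fun s hs hst y => by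
    have e : hG.schr W (-(one + c • hG.potential W (t - s))) + c • hG.heat (t - s) W
        = c • W - (2 : ℝ) • mulL W (one + c • hG.potential W (t - s)) := by
      simp only [schr, map_neg, _root_.add_apply, _root_.smul_apply,
        map_add, map_smul, hG.lapL_one, hG.lapL_potential]
      module
    rw [e]
    change 0 ≤ c * W y - 2 * (W y * (1 + c * hG.potential W (t - s) y))
    have h1 := mul_le_mul_of_nonneg_left (hpot (t - s) (by linarith) (by linarith) y) (hW0 y)
    rw [hc] at h1 ⊢
    linarith) x
  have h0 : hG.potential W 0 = 0 := by simp [potential]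
  rw [sub_self, h0, smul_zero, add_zero, map_neg, sub_zero] at this
  have h2 := hpot t ht htT x
  change -(1 + c * hG.potential W t x) ≤ -(exp (t • hG.schr W) one x) at this
  linarith

/-- The interval `[0,t]` is cut into pieces of length at most `T`; by positivity and the semigroup
law each piece contributes at most a factor `E`. -/
theorem exp_schr_one_le {T E : ℝ} (hT : 0 < T) (hE : 1 ≤ E) {W : Linf V}
    (hW0 : ∀ x, 0 ≤ W x)
    (hW : ∀ t, 0 ≤ t → t ≤ T → ∀ x, exp (t • hG.schr W) one x ≤ E) (n : ℕ) {t : ℝ} (ht : 0 ≤ t)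
    (htT : t ≤ (n + 1) * T) (x : V) : exp (t • hG.schr W) one x ≤ E ^ (n + 1) := by
  induction n generalizing t x with
  | zero => simpa using hW t ht (by simpa using htT) x
  | succ n ih =>
    rcases le_total t T with h | h
    · exact (hW t ht h x).trans (le_self_pow₀ hE (by omega))
    · have e : t • hG.schr W = ((t - T) + T) • hG.schr W := by simp
      rw [e, exp_add_smul, mul_apply_eq_comp]
      have h1 := (posOp_exp_smul (hG.posOp_schr_add hW0) (sub_nonneg.2 h)).mono
        (g := E • one) (fun y => by simpa using hW T hT.le le_rfl y) x
      rw [map_smul, smul_apply] at h1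
      refine h1.trans ?_
      rw [pow_succ']
      refine mul_le_mul_of_nonneg_left (ih (sub_nonneg.2 h) ?_ x) (by linarith)
      push_cast at htT
      linarith

/-! ### The reverse Poincaré inequality. -/

/-- The carré du champ operator of bounded functions. -/
def gamL (f g : Linf V) : Linf V :=
  (1 / 2 : ℝ) • (hG.lapL (mulL f g) - mulL f (hG.lapL g) - mulL g (hG.lapL f))

theorem gamL_apply (f g : Linf V) (x : V) : hG.gamL f g x = G.gam f g x := rfl

theorem hasDerivAt_gamL {u u' : ℝ → Linf V} (hu : ∀ s, HasDerivAt u (u' s) s) (s : ℝ) :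
    HasDerivAt (fun s => hG.gamL (u s) (u s)) ((2 : ℝ) • hG.gamL (u s) (u' s)) s := by
  have hl := hG.lapL.hasFDerivAt.comp_hasDerivAt s (hu s)
  have h1 := hG.lapL.hasFDerivAt.comp_hasDerivAt s
    ((mulL.hasFDerivAt.comp_hasDerivAt s (hu s)).clm_apply (hu s))
  have h2 := (mulL.hasFDerivAt.comp_hasDerivAt s (hu s)).clm_apply hl
  refine (((h1.sub h2).sub h2).const_smul (1 / 2 : ℝ)).congr_deriv ?_
  have hcomm : mulL (u' s) (u s) = mulL (u s) (u' s) := by ext x; simp [mul_comm]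
  simp only [gamL, map_add, Function.comp_apply, hcomm]
  module

/-- Under `Γ₂ ≥ (K - W) Γ` the heat semigroup satisfies a reverse Poincaré inequality with the
Schrödinger semigroup generated by `Δ + 2W` on the right-hand side. -/
theorem gam_heat_le {K : ℝ} (hK : 0 < K) {W : Linf V} (hW0 : ∀ x, 0 ≤ W x)
    (hΓ : ∀ (f : Linf V) (x : V), (K - W x) * G.gam f f x ≤ G.gam2 f f x) (f : Linf V) {t : ℝ}
    (ht : 0 ≤ t) (x : V) :
    (Real.exp (2 * K * t) - 1) / K * G.gam (hG.heat t f) (hG.heat t f) x ≤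
      exp (t • hG.schr W) (mulL f f) x := by
  set u : ℝ → Linf V := fun s => hG.heat (t - s) f with hu
  have hsub : ∀ s : ℝ, HasDerivAt (fun s : ℝ => t - s) (-1) s := fun s => by
    simpa using (hasDerivAt_id s).const_sub t
  have hu' : ∀ s, HasDerivAt u (-hG.lapL (u s)) s := fun s => by
    exact ((hasDerivAt_exp_smul_apply hG.lapL f (t - s)).scomp s (hsub s)).congr_deriv
      (neg_one_smul _ _)
  -- In `b' = -2 - 2Kb` the `-2` cancels the `2Γu` coming from `Δ(u²)`, and `-2Kb` absorbs the
  -- curvature `K`.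
  set b : ℝ → ℝ := fun s => (Real.exp (2 * K * (t - s)) - 1) / K with hb
  have hb' : ∀ s, HasDerivAt b (-2 - 2 * K * b s) s := fun s => by
    refine (((((hsub s).const_mul (2 * K)).exp).sub_const 1).div_const K).congr_deriv ?_
    simp only [hb]
    field_simp
    ring
  have hg : ∀ s, HasDerivAt (fun s => mulL (u s) (u s) + b s • hG.gamL (u s) (u s))
      ((mulL (-hG.lapL (u s)) (u s) + mulL (u s) (-hG.lapL (u s))) +
        (b s • (2 : ℝ) • hG.gamL (u s) (-hG.lapL (u s)) +
          (-2 - 2 * K * b s) • hG.gamL (u s) (u s))) s := fun s =>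
    ((mulL.hasFDerivAt.comp_hasDerivAt s (hu' s)).clm_apply (hu' s)).add
      ((hb' s).smul (hG.hasDerivAt_gamL hu' s))
  -- After cancellation the expression equals `2b (Γ₂u - (K - W) Γu) + 2W u²`, and `b ≥ 0` on
  -- `[0,t]`.
  have := le_exp_smul_apply (hG.posOp_schr_add hW0) ht hg (fun s hs hst y => by
    have hbs : 0 ≤ b s := by
      refine div_nonneg (sub_nonneg.2 (Real.one_le_exp ?_)) hK.le
      exact mul_nonneg (by linarith) (by linarith)
    have h2 := hΓ (u s) y
    have h3 := mul_nonneg (hW0 y) (sq_nonneg (u s y))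
    have hneg : hG.gamL (u s) (-hG.lapL (u s)) = -hG.gamL (u s) (hG.lapL (u s)) := by
      simp only [gamL, map_neg, _root_.neg_apply]
      module
    have e1 : hG.lapL (mulL (u s) (u s)) =
        (2 : ℝ) • hG.gamL (u s) (u s) + (2 : ℝ) • mulL (u s) (hG.lapL (u s)) := by
      simp only [gamL]
      module
    have e2 : G.lap (hG.gamL (u s) (u s)) y = 2 * G.gam2 (u s) (u s) y
        + 2 * hG.gamL (u s) (hG.lapL (u s)) y := by
      change G.lap (G.gam (u s) (u s)) y = 2 * (1 / 2 * (G.lap (G.gam (u s) (u s)) y -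
        G.gam (u s) (G.lap (u s)) y - G.gam (u s) (G.lap (u s)) y)) +
        2 * G.gam (u s) (G.lap (u s)) y
      ring
    have e3 : G.lap (mulL (u s) (u s)) y =
        2 * hG.gamL (u s) (u s) y + 2 * (u s y * hG.lapL (u s) y) :=
      congrArg (fun g : Linf V => g y) e1
    rw [hneg, map_add, map_smul]
    simp only [Linf.add_apply, Linf.smul_apply, schr_apply, mulL_apply, map_neg, Linf.neg_apply,
      _root_.neg_apply, e2, e3]
    have h4 := mul_le_mul_of_nonneg_left h2 hbs
    simp only [← hG.gamL_apply] at h4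
    nlinarith [h3, h4]) x
  have h0 : b t = 0 := by simp [hb]
  have h1 : u t = f := by simp [hu, heat, exp_zero]
  rw [h0, h1, zero_smul, add_zero] at this
  refine le_trans ?_ this
  simp only [Linf.add_apply, Linf.smul_apply, mulL_apply, gamL_apply, hb, hu, sub_zero]
  -- The term `(P_t f)²` at `s = 0` is discarded.
  have := mul_self_nonneg (hG.heat t f x)
  linarith

end BoundedDegree

end MeasuredWeightedGraph

end

/-! ### The gradient bound under the Kato condition. -/

open MeasuredWeightedGraph Linf in
theorem MeasuredWeightedGraph.BoundedDegree.gam_heat_le_of_kato {V : Type*}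
    {G : MeasuredWeightedGraph V} (hG : G.BoundedDegree)
    {K T : ℝ} (hK : 0 < K) (hT : 0 < T) {n : ℝ≥0∞} {ρ : V → ℝ} (hCD : G.CD ρ n)
    (hKato : hG.kato T (negPartFun fun x => ρ x - K) ≤
      ENNReal.ofReal (1 / 4 * (1 - Real.exp (-(K * T / 2)))))
    (f : Linf V) {t : ℝ} (ht : 0 < t) (x : V) :
    (Real.exp (2 * K * t) - 1) / K * G.gam (hG.heat t f) (hG.heat t f) x ≤
      Real.exp (K * (T + t) / 2) * ‖f‖ ^ 2 := by
  set κ := 1 / 4 * (1 - Real.exp (-(K * T / 2))) with hκdef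
  have hKT := mul_pos hK hT
  have hexp1 : Real.exp (-(K * T / 2)) ≤ 1 := Real.exp_le_one_iff.2 (by linarith)
  have hexp0 := Real.exp_pos (-(K * T / 2))
  have hκ : 0 ≤ κ := by rw [hκdef]; linarith
  obtain ⟨k, hk⟩ := hG.bddAbove_of_kato hT hκ hKato
  -- At this `k` the truncation changes nothing, so the Kato bound applies to `(ρ - K)_-` itself.
  set W : Linf V := trunc k (negPartFun fun x => ρ x - K)
  have hWx : ∀ x, W x = -min 0 (ρ x - K) := fun x => min_eq_right (hk x)
  have hW0 : ∀ x, 0 ≤ W x := fun x => by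
    rw [hWx]; exact neg_nonneg.2 (min_le_left _ _)
  have hΓ : ∀ (f : Linf V) (x : V), (K - W x) * G.gam f f x ≤ G.gam2 f f x := fun f x => by
    refine le_trans ?_ (hCD f ⟨‖f‖, f.abs_apply_le⟩ x)
    have h1 : K - W x ≤ ρ x := by
      rw [hWx]
      linarith [min_le_right 0 (ρ x - K)]
    have h2 := mul_le_mul_of_nonneg_right h1 (G.gam_self_nonneg f x)
    have h3 : 0 ≤ (n⁻¹).toReal * (G.lap f x) ^ 2 := by positivity
    linarith
  have hE : ∀ s, 0 ≤ s → s ≤ T → ∀ x, exp (s • hG.schr W) one x ≤ Real.exp (K * T / 2) :=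
    fun s hs hsT x => by
      refine (hG.exp_schr_one_le_of_le hκ (by rw [hκdef]; linarith) hW0
        ((le_iSup (fun k : ℕ => ∫⁻ t in Set.Ioc 0 T,
          ‖hG.heat t (trunc k (negPartFun fun x => ρ x - K))‖ₑ) k).trans hKato) hs hsT x).trans ?_
      -- Here `1 - 2κ = (1 + e^{-KT/2})/2 ≥ e^{-KT/2}`.
      rw [← inv_inv (Real.exp (K * T / 2)), ← Real.exp_neg]
      refine inv_anti₀ hexp0 ?_
      rw [hκdef]
      linarith
  have hone : exp (t • hG.schr W) one x ≤ Real.exp (K * (T + t) / 2) := by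
    -- The number of pieces is `⌊t/T⌋ + 1`, and `(⌊t/T⌋ + 1) T ≤ t + T`.
    have h1 := hG.exp_schr_one_le hT (Real.one_le_exp (by linarith)) hW0 hE ⌊t / T⌋₊ ht.le
      (by rw [← div_le_iff₀ hT]; exact (Nat.lt_floor_add_one _).le) x
    refine h1.trans ?_
    rw [← Real.exp_nat_mul, Real.exp_le_exp]
    have h2 := Nat.floor_le (div_nonneg ht.le hT.le)
    rw [le_div_iff₀ hT] at h2
    push_cast
    nlinarith
  refine (hG.gam_heat_le hK hW0 hΓ f ht.le x).trans ?_
  have h1 := (posOp_exp_smul (hG.posOp_schr_add hW0) ht.le).mono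
    (f := mulL f f) (g := (‖f‖ ^ 2) • one) (fun y => by
      rw [mulL_apply, smul_apply, one_apply, mul_one, ← sq, ← sq_abs]
      exact pow_le_pow_left₀ (abs_nonneg _) (f.abs_apply_le y) 2) x
  rw [map_smul, smul_apply] at h1
  refine h1.trans ?_
  rw [mul_comm]
  exact mul_le_mul_of_nonneg_right hone (sq_nonneg _)

theorem mainTheorem9 {V : Type*} (G : MeasuredWeightedGraph V) (hG : G.BoundedDegree)
    (K T : ℝ) (hK : 0 < K) (hT : 0 < T) (n : ℝ≥0∞) (hn : 0 < n) (ρ : V → ℝ)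
    (hCD : G.CD ρ n)
    (hKato : hG.kato T (MeasuredWeightedGraph.negPartFun fun x => ρ x - K) ≤
      ENNReal.ofReal (1 / 4 * (1 - Real.exp (-(K * T / 2)))))
    (f : Linf V) (t : ℝ) (ht : 0 < t) :
    (∀ x : V, G.gam (hG.heat t f) (hG.heat t f) x ≤
      K * Real.exp (K * T) * (1 / Real.sinh (K * t)) * ‖f‖ ^ 2) ∧
    K * Real.exp (K * T) * (1 / Real.sinh (K * t)) * ‖f‖ ^ 2 ≤
      Real.exp (K * T) / t * ‖f‖ ^ 2 := by
  have hKt : 0 < K * t := mul_pos hK ht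
  have hKT : 0 < K * T := mul_pos hK hT
  have hsinh : 0 < Real.sinh (K * t) := Real.sinh_pos_iff.2 hKt
  constructor
  · intro x
    have h := hG.gam_heat_le_of_kato hK hT hCD hKato f ht x
    have e : Real.exp (2 * K * t) - 1 = 2 * Real.exp (K * t) * Real.sinh (K * t) := by
      rw [Real.sinh_eq, Real.exp_neg, show 2 * K * t = K * t + K * t by ring, Real.exp_add]
      field_simp
    -- A lossy bound, shaped so that `2 e^{Kt}` cancels against the same factor in `e`.
    have hle : Real.exp (K * (T + t) / 2) ≤ Real.exp (K * T) * (2 * Real.exp (K * t)) := by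
      have h1 : Real.exp (K * (T + t) / 2) ≤ Real.exp (K * T + K * t) :=
        Real.exp_le_exp.2 (by nlinarith)
      rw [Real.exp_add] at h1
      have := mul_pos (Real.exp_pos (K * T)) (Real.exp_pos (K * t))
      linarith
    have h2 := h.trans (mul_le_mul_of_nonneg_right hle (sq_nonneg ‖f‖))
    rw [e] at h2
    set γ := G.gam (hG.heat t f) (hG.heat t f) x
    have hE := Real.exp_pos (K * t)
    have h3 : (2 * Real.exp (K * t)) * (Real.sinh (K * t) / K * γ) ≤
        (2 * Real.exp (K * t)) * (Real.exp (K * T) * ‖f‖ ^ 2) := by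
      calc _ = 2 * Real.exp (K * t) * Real.sinh (K * t) / K * γ := by ring
        _ ≤ _ := h2
        _ = _ := by ring
    have h4 := le_of_mul_le_mul_left h3 (by positivity)
    calc γ = K * (1 / Real.sinh (K * t)) * (Real.sinh (K * t) / K * γ) := by field_simp
      _ ≤ K * (1 / Real.sinh (K * t)) * (Real.exp (K * T) * ‖f‖ ^ 2) := by gcongr
      _ = _ := by ring
  · refine mul_le_mul_of_nonneg_right ?_ (sq_nonneg _)
    have h1 : K * t ≤ Real.sinh (K * t) := Real.self_le_sinh_iff.2 hKt.le
    calc K * Real.exp (K * T) * (1 / Real.sinh (K * t))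
        ≤ K * Real.exp (K * T) * (1 / (K * t)) := by gcongr
      _ = _ := by field_simp
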